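/- Let $n\ge 1$, let $X=\mathbb{R}^n$ with an arbitrary norm $\|\cdot\|$, let $U=(0,\infty)^n$, and let $q\in\mathbb{R}\setminus\{0,1\}$. Define $b:X\to(-\infty,\infty]$ as follows. If $q>0$, then $b(x)=\frac{1}{q-1}\sum_{k=1}^n(x_k^q-1)$ for $x\in\overline U=[0,\infty)^n$ and $b(x)=\infty$ otherwise. If $q<0$, then $b(x)=\frac{1}{1-q}\sum_{k=1}^n(x_k^q-1)$ for $x\in U$ and $b(x)=\infty$ otherwise. **Definitions.** Let $\mathrm{dom}(b)=\{x: b(x)<\infty\}$. For $S_1,S_2\subseteq\mathrm{dom}(b)$, a function $\psi:[0,\infty)\to[0,\infty]$ is a *relative gauge* of $b$ on $(S_1,S_2)$ if $\psi(t)>0$ for all $t>0$ and $$b(\lambda x+(1-\lambda)y)+\lambda(1-\lambda)\psi(\|x-y\|)\le\lambda b(x)+(1-\lambda)b(y)$$ for all $x\in S_1$, $y\in S_2$, $\lambda\in(0,1)$. The function $b$ is *uniformly convex on $S$* if it has a gauge on $(S,S)$. It is *strongly convex on $S$ with parameter $\mu>0$* if $\frac{\mu}{2}t^2$ is such a gauge,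 and *strongly convex on $S$* if this holds for some $\mu>0$. Let $B(x,y)=b(x)-b(y)-\langle b'(y),x-y\rangle$ for $x\in\mathrm{dom}(b)$ and $y\in\mathrm{Int}(\mathrm{dom}(b))$, and $B(x,y)=\infty$ otherwise, where $b'$ is the Gâteaux derivative. The function $b$ is a *Bregman function with zone $V\neq\emptyset$* if the following hold: 1. $V=\mathrm{Int}(\mathrm{dom}(b))$ and $b$ is Gâteaux differentiable on $V$. 2. $b$ is convex and lower semicontinuous on $X$ and strictly convex on $\mathrm{dom}(b)$. 3. For all $x\in\mathrm{dom}(b)$ and $\gamma\in\mathbb{R}$, the level set $\{y\in V: B(x,y)\le\gamma\}$ is bounded. 4. If $x\in\mathrm{dom}(b)$, $y_i\in V$ and $y_i\to x$, then $B(x,y_i)\to0$. 5. If $(x_i)$ is a bounded sequence in $\mathrm{dom}(b)$, $y_i\in V$, $y_i\to y\in\mathrm{dom}(b)$ and $B(x_i,y_i)\to0$, then $x_i\to y$. It has the *limiting difference property* if $B(x,y)=\lim_i(B(x,y_i)-B(y,y_i))$ whenever $x\in\mathrm{dom}(b)$ and $y_i\in\mathrm{Int}(\mathrm{dom}(b))$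 converge weakly to $y\in\mathrm{Int}(\mathrm{dom}(b))$. It is *sequentially consistent* if $\|x_i-y_i\|\to0$ whenever $x_i\in\mathrm{dom}(b)$, $(y_i)$ is a bounded sequence in $\mathrm{Int}(\mathrm{dom}(b))$ and $B(x_i,y_i)\to0$. **Statement.** The function $b$ is convex, $\mathrm{Int}(\mathrm{dom}(b))=U$, and $b$ is Gâteaux differentiable on $U$. There are constants $c_2,c_\infty>0$ such that $c_2\|v\|\le\|v\|_2$ and $\|v\|_\infty\le c_\infty\|v\|$ for all $v$. For all such constants $c_2,c_\infty$: - Suppose $q<2$. If $S\subseteq\mathrm{dom}(b)$ is nonempty, bounded and convex, and $M>0$ bounds the norms of the vectors of $S$, then $b$ is strongly convex on $S$ with parameter $|q|c_2^2/(c_\infty M)^{2-q}$. Moreover, for each $x\in\mathrm{dom}(b)$, the function $\psi(t)=\frac{|q|c_2^2}{c_\infty^{2-q}2^{3-q}}t^q$ for $t>0$, $\psi(0)=0$, is a relative gauge of $b$ on $(\{x\},\,U\cap\{w:\|w\|>2\|x\|\})$. - If $q=2$, then $b$ is strongly convex on $\mathrm{dom}(b)=\overline U$ with parameter $2c_2^2$.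 - Suppose $q>2$. For every $\varepsilon>0$, $b$ is strongly convex with parameter $q c_2^2\varepsilon^{q-2}$ on every nonempty subset of $[\varepsilon,\infty)^n$. Thus $b$ is strongly convex on every nonempty $V\subseteq U$ whose distance to the boundary of $U$ is positive. - If $q\in(0,\infty)\setminus\{1,2\}$, then $b$ is not strongly convex on $U$. If $q>2$, it is not strongly convex even on any half-open interval $[x,y)$, where $x_k=a>0$ and $y_k=0$ for one index $k$ and $x_j=y_j=1$ for all $j\ne k$. - If $q=\frac12$, then $b$ is not uniformly convex on $U$. - If $q>0$, then $b$ is a sequentially consistent Bregman function with zone $U$ which has the limiting difference property, and the sets $\{x\in\mathrm{dom}(b): B(x,y)\le\gamma\}$ are bounded for all $y\in U$ and $\gamma\in\mathbb{R}$. - If $q<0$, then $b$ is not a Bregman function (with respect to any zone). Indeed, for every $x\in[1,\infty)^n$ and every $\gamma>\max_k n x_k^q/(1-q)$, the level set $\{y\in U: B(x,y)\le\gamma\}$ is unbounded. -/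

import Mathlib

open Filter Topology
open scoped NNReal ENNReal

noncomputable section

namespace BregmanTsallis

section General

variable {X : Type*} [NormedAddCommGroup X] [NormedSpace ℝ X]

/-- The effective domain of an extended-valued function. Functions with values in `(-∞, ∞]` are
modelled as functions `X → EReal` which never take the value `⊥`. -/
def dom (b : X → EReal) : Set X := {x | b x < ⊤}

/-- Convexity on the whole space of a function with values in `(-∞, ∞]`. -/
def IsConvex (b : X → EReal) : Prop :=
  ∀ x y : X, ∀ t ∈ Set.Ioo (0 : ℝ) 1,
    b (t • x + (1 - t) • y) ≤ (t : EReal) * b x + ((1 - t : ℝ) : EReal) * b y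

/-- Strict convexity of `b` on the set `S`. -/
def IsStrictlyConvexOn (b : X → EReal) (S : Set X) : Prop :=
  ∀ x ∈ S, ∀ y ∈ S, x ≠ y → ∀ t ∈ Set.Ioo (0 : ℝ) 1,
    b (t • x + (1 - t) • y) < (t : EReal) * b x + ((1 - t : ℝ) : EReal) * b y

/-- `ψ : [0, ∞) → [0, ∞]` is a relative gauge of `b` on `(S₁, S₂)`. -/
def IsRelativeGauge (b : X → EReal) (S₁ S₂ : Set X) (ψ : ℝ≥0 → ℝ≥0∞) : Prop :=
  (∀ r : ℝ≥0, 0 < r → 0 < ψ r) ∧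
  ∀ x ∈ S₁, ∀ y ∈ S₂, ∀ t ∈ Set.Ioo (0 : ℝ) 1,
    b (t • x + (1 - t) • y) + ((t * (1 - t) : ℝ) : EReal) * (ψ ‖x - y‖₊ : EReal)
      ≤ (t : EReal) * b x + ((1 - t : ℝ) : EReal) * b y

/-- Uniform convexity of `b` on `S`: there is a gauge on `(S, S)`. -/
def IsUniformlyConvexOn (b : X → EReal) (S : Set X) : Prop :=
  ∃ ψ : ℝ≥0 → ℝ≥0∞, IsRelativeGauge b S S ψ

/-- `μ > 0` is a parameter of strong convexity of `b` on `S`: the function `t ↦ μ t² / 2` is a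
gauge of `b` on `(S, S)`. -/
def IsStrongConvexityParameter (b : X → EReal) (S : Set X) (μ : ℝ) : Prop :=
  0 < μ ∧ IsRelativeGauge b S S (fun r => ENNReal.ofReal (1 / 2 * μ * (r : ℝ) ^ 2))

/-- Strong convexity of `b` on `S`. -/
def IsStronglyConvexOn (b : X → EReal) (S : Set X) : Prop :=
  ∃ μ : ℝ, IsStrongConvexityParameter b S μ

/-- The continuous linear functional `L` is the Gâteaux derivative of `b` at the point `y` of the
interior of the effective domain (so that `b` is finite near `y`). -/
def HasGateauxDerivAt (b : X → EReal) (L : X →L[ℝ] ℝ) (y : X) : Prop :=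
  y ∈ interior (dom b) ∧ ∀ v : X, HasLineDerivAt ℝ (fun z => (b z).toReal) (L v) y v

open Classical in
/-- The Gâteaux derivative of `b` at `y` (zero if there is none). -/
def gateauxDeriv (b : X → EReal) (y : X) : X →L[ℝ] ℝ :=
  if h : ∃ L : X →L[ℝ] ℝ, HasGateauxDerivAt b L y then h.choose else 0

/-- A pre-Bregman function: the interior of the effective domain (the zone) is nonempty, and the
function is Gâteaux differentiable there. -/
structure IsPreBregman (b : X → EReal) : Prop where
  ne_bot : ∀ x, b x ≠ ⊥
  nonempty : (interior (dom b)).Nonempty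
  differentiable : ∀ y ∈ interior (dom b), ∃ L : X →L[ℝ] ℝ, HasGateauxDerivAt b L y

open Classical in
/-- The (pre-)Bregman divergence `B` associated with `b`. -/
def divergence (b : X → EReal) (x y : X) : EReal :=
  if x ∈ dom b ∧ y ∈ interior (dom b) then
    (((b x).toReal - (b y).toReal - gateauxDeriv b y (x - y) : ℝ) : EReal)
  else ⊤

/-- The first type level-set of the divergence. -/
def levelSet₁ (b : X → EReal) (x : X) (γ : ℝ) : Set X :=
  {y | y ∈ interior (dom b) ∧ divergence b x y ≤ (γ : EReal)}

/-- The second type level-set of the divergence. -/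
def levelSet₂ (b : X → EReal) (y : X) (γ : ℝ) : Set X :=
  {x | x ∈ dom b ∧ divergence b x y ≤ (γ : EReal)}

/-- `b` is a Bregman function with zone `U`. -/
structure IsBregman (b : X → EReal) (U : Set X) : Prop where
  ne_bot : ∀ x, b x ≠ ⊥
  zone_nonempty : U.Nonempty
  zone_eq : U = interior (dom b)
  differentiable : ∀ y ∈ U, ∃ L : X →L[ℝ] ℝ, HasGateauxDerivAt b L y
  convex : IsConvex b
  lsc : LowerSemicontinuous b
  strictlyConvex : IsStrictlyConvexOn b (dom b)
  bounded_levelSet : ∀ γ : ℝ, ∀ x ∈ dom b, Bornology.IsBounded (levelSet₁ b x γ)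
  tendsto_divergence : ∀ x ∈ dom b, ∀ y : ℕ → X, (∀ i, y i ∈ U) →
    Tendsto y atTop (𝓝 x) → Tendsto (fun i => divergence b x (y i)) atTop (𝓝 0)
  tendsto_of_divergence : ∀ x y : ℕ → X, (∀ i, x i ∈ dom b) → (∀ i, y i ∈ U) →
    Bornology.IsBounded (Set.range x) →
    Tendsto (fun i => divergence b (x i) (y i)) atTop (𝓝 0) →
    ∀ z ∈ dom b, Tendsto y atTop (𝓝 z) → Tendsto x atTop (𝓝 z)

/-- The limiting difference property; weak convergence is convergence against every continuous
linear functional. -/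
def LimitingDifference (b : X → EReal) : Prop :=
  ∀ x ∈ dom b, ∀ y : ℕ → X, (∀ i, y i ∈ interior (dom b)) → ∀ z ∈ interior (dom b),
    (∀ f : X →L[ℝ] ℝ, Tendsto (fun i => f (y i)) atTop (𝓝 (f z))) →
    Tendsto (fun i => divergence b x (y i) - divergence b z (y i)) atTop
      (𝓝 (divergence b x z))

/-- Sequential consistency. -/
def SequentiallyConsistent (b : X → EReal) : Prop :=
  ∀ x y : ℕ → X, (∀ i, x i ∈ dom b) → (∀ i, y i ∈ interior (dom b)) →
    Bornology.IsBounded (Set.range y) →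
    Tendsto (fun i => divergence b (x i) (y i)) atTop (𝓝 0) →
    Tendsto (fun i => ‖x i - y i‖) atTop (𝓝 0)

end General

section Tsallis

/-! The space `ℝⁿ` with an arbitrary norm is a real normed space `X` together with a linear
coordinate isomorphism `e : X ≃ₗ[ℝ] (Fin n → ℝ)`; the `k`-th coordinate of `x` is `e x k`. -/

variable {X : Type*} [NormedAddCommGroup X] [NormedSpace ℝ X] {n : ℕ}

/-- The open positive orthant `(0, ∞)ⁿ`. -/
def orthant (e : X ≃ₗ[ℝ] (Fin n → ℝ)) : Set X := {x | ∀ k, 0 < e x k}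

open Classical in
/-- The negative Havrda-Charvát-Tsallis entropy with parameter `q ≠ 0, 1`. -/
def tsallis (e : X ≃ₗ[ℝ] (Fin n → ℝ)) (q : ℝ) (x : X) : EReal :=
  if 0 < q then
    if ∀ k, 0 ≤ e x k then ((1 / (q - 1) * ∑ k, ((e x k) ^ q - 1) : ℝ) : EReal) else ⊤
  else
    if ∀ k, 0 < e x k then ((1 / (1 - q) * ∑ k, ((e x k) ^ q - 1) : ℝ) : EReal) else ⊤

/-- `c₂` and `c_∞` are positive constants with `c₂ ‖v‖ ≤ ‖v‖₂` and `‖v‖_∞ ≤ c_∞ ‖v‖`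
for all `v`. -/
def AreNormConstants (e : X ≃ₗ[ℝ] (Fin n → ℝ)) (c₂ cinf : ℝ) : Prop :=
  0 < c₂ ∧ 0 < cinf ∧ (∀ v : X, c₂ * ‖v‖ ≤ Real.sqrt (∑ k, (e v k) ^ 2)) ∧
    ∀ v : X, ∀ k, |e v k| ≤ cinf * ‖v‖

/-- The relative gauge `ψ(t) = |q| c₂² t^q / (c_∞^(2-q) 2^(3-q))` for `t > 0`, `ψ(0) = 0`. -/
def tsallisGauge (q c₂ cinf : ℝ) (r : ℝ≥0) : ℝ≥0∞ :=
  if r = 0 then 0 else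
    ENNReal.ofReal (|q| * c₂ ^ 2 / (cinf ^ (2 - q) * (2 : ℝ) ^ (3 - q)) * (r : ℝ) ^ q)

end Tsallis

end BregmanTsallis

end

noncomputable section

namespace BregmanTsallis

section Potential

/-! ### The one-dimensional potential -/

/-! The function is separable: on its domain it is the sum over coordinates of one potential `pot
q`, normalised so that its second derivative is `|q| * t ^ (q - 2)`, whatever the sign of `q`. The
argument is the study of this one function.

If the second derivative is at least `μ` between the coordinates of two points, then `pot q` minus
`μ / 2 * t ^ 2` is convex there. Summing over coordinates and using `c₂ * ‖v‖ ≤ ‖v‖₂` gives strong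
convexity with parameter `μ * c₂ ^ 2` (`sumPot_gap`). For `q < 2` the second derivative decreases,
so its bound comes from the largest coordinate, at most `cinf * M`; for `q = 2` it is constant; for
`q > 2` it increases, so the bound comes from the smallest coordinate `ε`. The failures occur where
it vanishes: at infinity for `q < 2`, at `0` for `q > 2`.

The divergence is a sum of nonnegative one-variable divergences, so a bound on it bounds each of
them. For `q > 0` the one-variable divergence is coercive in either variable and, while its second
argument stays bounded, is bounded away from `0` off the diagonal (`exists_potDiv_ge`); this gives
bounded level sets and sequential consistency. For `q < 0` it tends to the finite limit `s ^ q / (1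
- q)` as its second argument grows, so some level sets contain a far part of the diagonal ray. -/

/-- The normalising factor of the negative Tsallis entropy. -/
def coef (q : ℝ) : ℝ := if 0 < q then 1 / (q - 1) else 1 / (1 - q)

/-- The negative Tsallis entropy of a single coordinate. -/
def pot (q t : ℝ) : ℝ := coef q * (t ^ q - 1)

/-- The derivative of `pot q`. -/
def dpot (q t : ℝ) : ℝ := coef q * (q * t ^ (q - 1))

/-- The effective domain of `pot q`. -/
def potDom (q : ℝ) : Set ℝ := if 0 < q then Set.Ici 0 else Set.Ioi 0

/-- The divergence of `pot q`. -/
def potDiv (q s t : ℝ) : ℝ := pot q s - pot q t - dpot q t * (s - t)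

variable {q s t : ℝ}

lemma potDom_of_pos (hq : 0 < q) : potDom q = Set.Ici 0 := if_pos hq

lemma nonneg_of_mem_potDom (h : t ∈ potDom q) : 0 ≤ t := by
  unfold potDom at h
  split_ifs at h
  · exact h
  · exact le_of_lt h

lemma mem_potDom_of_pos (h : 0 < t) : t ∈ potDom q := by
  unfold potDom
  split_ifs
  · exact h.le
  · exact h

lemma convex_potDom : Convex ℝ (potDom q) := by
  unfold potDom
  split_ifs
  · exact convex_Ici 0
  · exact convex_Ioi 0

lemma interior_potDom : interior (potDom q) = Set.Ioi 0 := by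
  unfold potDom
  split_ifs
  · exact interior_Ici
  · exact interior_Ioi

/-- The sign switch in `coef` at `q = 0` is exactly what makes the second derivative positive for
every admissible `q`. -/
lemma coef_mul (hq0 : q ≠ 0) (hq1 : q ≠ 1) : coef q * (q * (q - 1)) = |q| := by
  have h1 : q - 1 ≠ 0 := sub_ne_zero.2 hq1
  have h2 : 1 - q ≠ 0 := sub_ne_zero.2 hq1.symm
  unfold coef
  split_ifs with h
  · rw [abs_of_pos h]
    field_simp
  · rw [abs_of_nonpos (not_lt.1 h)]
    field_simp
    ring

/-! ### Derivatives and convexity of the potential -/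

lemma hasDerivAt_pot (ht : 0 < t) : HasDerivAt (pot q) (dpot q t) t :=
  ((Real.hasDerivAt_rpow_const (Or.inl ht.ne')).sub_const 1).const_mul _

lemma hasDerivAt_dpot (hq0 : q ≠ 0) (hq1 : q ≠ 1) (ht : 0 < t) :
    HasDerivAt (dpot q) (|q| * t ^ (q - 2)) t := by
  have h := ((Real.hasDerivAt_rpow_const (p := q - 1) (Or.inl ht.ne')).const_mul q).const_mul
    (coef q)
  refine h.congr_deriv ?_
  rw [← coef_mul hq0 hq1, show q - 1 - 1 = q - 2 by ring]
  ring

lemma continuous_pot (hq : 0 < q) : Continuous (pot q) :=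
  ((Real.continuous_rpow_const hq.le).sub continuous_const).const_mul _

lemma continuousOn_pot : ContinuousOn (pot q) (potDom q) := by
  by_cases hq : 0 < q
  · exact (continuous_pot hq).continuousOn
  · intro t ht
    simp only [potDom, if_neg hq] at ht
    exact (hasDerivAt_pot ht).continuousAt.continuousWithinAt

/-- The second derivative is nonnegative on the interior of `D`, which omits `0`; the endpoint `0`,
where derivatives may blow up, needs continuity only. -/
lemma convexOn_pot_sub (hq0 : q ≠ 0) (hq1 : q ≠ 1) {D : Set ℝ} (hD : Convex ℝ D)
    (hsub : D ⊆ potDom q) {μ : ℝ} (hμ : ∀ t ∈ D, 0 < t → μ ≤ |q| * t ^ (q - 2)) :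
    ConvexOn ℝ D (fun t => pot q t - μ / 2 * t ^ 2) := by
  have hpos : ∀ t ∈ interior D, 0 < t := fun t ht => by
    have := interior_mono hsub ht
    rwa [interior_potDom] at this
  refine convexOn_of_hasDerivWithinAt2_nonneg hD (f' := fun t => dpot q t - μ * t)
    (f'' := fun t => |q| * t ^ (q - 2) - μ) ?_ ?_ ?_ ?_
  · exact (continuousOn_pot.mono hsub).sub (by fun_prop)
  · intro t ht
    have h := (hasDerivAt_pot (q := q) (hpos t ht)).sub
      ((hasDerivAt_pow 2 t).const_mul (μ / 2))
    exact (h.congr_deriv (by push_cast; ring)).hasDerivWithinAt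
  · intro t ht
    have h := (hasDerivAt_dpot hq0 hq1 (hpos t ht)).sub ((hasDerivAt_id t).const_mul μ)
    exact (h.congr_deriv (by rw [mul_one])).hasDerivWithinAt
  · intro t ht
    have := hμ t (interior_subset ht) (hpos t ht)
    linarith

lemma uIcc_subset_potDom (hs : s ∈ potDom q) (ht : t ∈ potDom q) :
    Set.uIcc s t ⊆ potDom q :=
  convex_potDom.ordConnected.uIcc_subset hs ht

/-- Strong convexity of `pot q` between two points. -/
lemma pot_gap (hq0 : q ≠ 0) (hq1 : q ≠ 1) {x y μ a : ℝ} (hx : x ∈ potDom q) (hy : y ∈ potDom q)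
    (hμ : ∀ t ∈ Set.uIcc x y, 0 < t → μ ≤ |q| * t ^ (q - 2)) (ha : a ∈ Set.Ioo (0 : ℝ) 1) :
    pot q (a * x + (1 - a) * y) + a * (1 - a) * (μ / 2 * (x - y) ^ 2)
      ≤ a * pot q x + (1 - a) * pot q y := by
  have h := (convexOn_pot_sub hq0 hq1 (convex_uIcc x y) (uIcc_subset_potDom hx hy) hμ).2
    Set.left_mem_uIcc Set.right_mem_uIcc ha.1.le (sub_nonneg.2 ha.2.le) (by ring)
  simp only [smul_eq_mul] at h
  -- The quadratic part is the identity `a x² + (1-a) y² - (a x + (1-a) y)² = a (1-a) (x-y)²`.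
  nlinarith [h]

/-- Tangent-line inequality at `y` for the convex function `pot q - μ / 2 * t ^ 2`; the quadratic
has divergence `μ / 2 * (x - y) ^ 2`. -/
lemma potDiv_lower (hq0 : q ≠ 0) (hq1 : q ≠ 1) {x y μ : ℝ} (hx : x ∈ potDom q) (hy : 0 < y)
    (hμ : ∀ t ∈ Set.uIcc x y, 0 < t → μ ≤ |q| * t ^ (q - 2)) :
    μ / 2 * (x - y) ^ 2 ≤ potDiv q x y := by
  have hc := convexOn_pot_sub hq0 hq1 (convex_uIcc x y)
    (uIcc_subset_potDom hx (mem_potDom_of_pos hy)) hμ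
  have hd : HasDerivAt (fun t => pot q t - μ / 2 * t ^ 2) (dpot q y - μ * y) y := by
    have h := (hasDerivAt_pot (q := q) hy).sub ((hasDerivAt_pow 2 y).const_mul (μ / 2))
    exact h.congr_deriv (by push_cast; ring)
  unfold potDiv
  rcases lt_trichotomy x y with h | h | h
  · have := hc.slope_le_of_hasDerivAt Set.left_mem_uIcc Set.right_mem_uIcc h hd
    rw [slope_def_field, div_le_iff₀ (by linarith)] at this
    nlinarith [this]
  · subst h
    simp
  · have := hc.le_slope_of_hasDerivAt Set.right_mem_uIcc Set.left_mem_uIcc h hd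
    rw [slope_def_field, le_div_iff₀ (by linarith)] at this
    nlinarith [this]

lemma potDiv_nonneg (hq0 : q ≠ 0) (hq1 : q ≠ 1) (hs : s ∈ potDom q) (ht : 0 < t) :
    0 ≤ potDiv q s t := by
  have h := potDiv_lower hq0 hq1 hs ht (μ := 0) (fun u _ hu => by positivity)
  linarith

lemma strictConvexOn_pot (hq0 : q ≠ 0) (hq1 : q ≠ 1) : StrictConvexOn ℝ (potDom q) (pot q) := by
  refine strictConvexOn_of_deriv2_pos convex_potDom continuousOn_pot fun x hx => ?_
  rw [interior_potDom] at hx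
  have hd : deriv (pot q) =ᶠ[𝓝 x] dpot q := by
    filter_upwards [Ioi_mem_nhds hx] with u hu
    exact (hasDerivAt_pot hu).deriv
  simp only [Function.iterate_succ, Function.iterate_zero, Function.comp_apply, id_eq]
  rw [hd.deriv_eq, (hasDerivAt_dpot hq0 hq1 hx).deriv]
  have := Real.rpow_pos_of_pos hx (q - 2)
  positivity

/-! ### Growth and separation estimates for the one-variable divergence -/

/-- Beyond a point to the right of `t`, the divergence from `t` only grows, at least linearly. -/
lemma potDiv_growth (hq0 : q ≠ 0) (hq1 : q ≠ 1) {d : ℝ} (hd : 0 < d) (ht : 0 < t)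
    (hs : t + d ≤ s) : (s - t) / d * potDiv q (t + d) t ≤ potDiv q s t := by
  have hst : 0 < s - t := by linarith
  -- `t + d` is the convex combination of `s` and `t` with weight `d / (s - t)` on `s`, and the
  -- divergence from `t` is convex and vanishes at `t`.
  have h := (strictConvexOn_pot hq0 hq1).convexOn.2
    (mem_potDom_of_pos (by linarith : 0 < s)) (mem_potDom_of_pos ht)
    (by positivity : 0 ≤ d / (s - t)) (sub_nonneg.2 ((div_le_one hst).2 (by linarith : d ≤ s - t))) (by ring)
  have he : (d / (s - t)) • s + (1 - d / (s - t)) • t = t + d := by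
    simp only [smul_eq_mul]
    field_simp
    ring
  rw [he] at h
  simp only [smul_eq_mul] at h
  have h2 : potDiv q (t + d) t ≤ d / (s - t) * potDiv q s t := by
    unfold potDiv
    have : d / (s - t) * (s - t) = d := by field_simp
    have e1 : d / (s - t) * (pot q s - pot q t - dpot q t * (s - t))
      = d / (s - t) * pot q s - d / (s - t) * pot q t - dpot q t * d := by
      rw [← this]
      field_simp
    rw [e1]
    linarith
  calc _ ≤ (s - t) / d * (d / (s - t) * potDiv q s t) :=
        mul_le_mul_of_nonneg_left h2 (by positivity)
    _ = _ := by field_simp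

lemma potDiv_le_of_le (hq0 : q ≠ 0) (hq1 : q ≠ 1) {d : ℝ} (hd : 0 < d) (ht : 0 < t)
    (hs : t + d ≤ s) : potDiv q (t + d) t ≤ potDiv q s t := by
  refine le_trans ?_ (potDiv_growth hq0 hq1 hd ht hs)
  exact le_mul_of_one_le_left
    (potDiv_nonneg hq0 hq1 (mem_potDom_of_pos (by linarith)) ht)
    ((one_le_div hd).2 (by linarith))

lemma potDiv_pos (hq0 : q ≠ 0) (hq1 : q ≠ 1) (hs : s ∈ potDom q) (ht : 0 < t) (hst : s ≠ t) :
    0 < potDiv q s t := by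
  have hc := strictConvexOn_pot hq0 hq1
  have hd := hasDerivAt_pot (q := q) ht
  unfold potDiv
  rcases hst.lt_or_gt with h | h
  · have := hc.slope_lt_of_hasDerivAt hs (mem_potDom_of_pos ht) h hd
    rw [slope_def_field, div_lt_iff₀ (by linarith)] at this
    nlinarith [this]
  · have := hc.lt_slope_of_hasDerivAt (mem_potDom_of_pos ht) hs h hd
    rw [slope_def_field, lt_div_iff₀ (by linarith)] at this
    nlinarith [this]

/-- The additive constant cancels. For `q > 1` the right-hand side extends continuously to `t = 0`,
which permits compactness arguments. -/
lemma potDiv_eq (ht : 0 < t) :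
    potDiv q s t = coef q * (s ^ q + (q - 1) * t ^ q - q * s * t ^ (q - 1)) := by
  have h : t ^ q = t ^ (q - 1) * t := by
    rw [← Real.rpow_add_one ht.ne']
    ring_nf
  unfold potDiv pot dpot
  rw [h]
  ring

/-- Superlinear growth of the divergence in its second argument. -/
lemma le_of_potDiv_le (hq : 0 < q) (hq1 : q ≠ 1) (s γ : ℝ) :
    ∃ R, ∀ t, 0 < t → potDiv q s t ≤ γ → t ≤ R := by
  -- This is the divergence with `t ^ q` factored out, since `coef q * (q - 1) = 1` for `q > 0`; the
  -- bracket tends to `1`.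
  have hl : Tendsto (fun t : ℝ => coef q * s ^ q + t ^ q * (1 - coef q * (q * s) * t⁻¹))
      atTop atTop := by
    refine tendsto_atTop_add_const_left _ _ ?_
    refine (tendsto_rpow_atTop hq).atTop_mul_pos (C := 1) one_pos ?_
    simpa using (tendsto_const_nhds (x := (1 : ℝ))).sub
      (tendsto_inv_atTop_zero.const_mul (coef q * (q * s)))
  obtain ⟨R, hR⟩ := eventually_atTop.1 (hl.eventually_gt_atTop γ)
  refine ⟨R, fun t ht h => ?_⟩
  by_contra hlt
  have h1 := hR t (not_le.1 hlt).le
  have h2 : coef q * (q - 1) = 1 := by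
    rw [coef, if_pos hq]
    exact one_div_mul_cancel (sub_ne_zero.2 hq1)
  rw [potDiv_eq ht, Real.rpow_sub_one ht.ne'] at h
  have h3 : coef q * (s ^ q + (q - 1) * t ^ q - q * s * (t ^ q / t))
      = coef q * s ^ q + t ^ q * (coef q * (q - 1) - coef q * (q * s) * t⁻¹) := by
    rw [div_eq_mul_inv]
    ring
  rw [h3, h2] at h
  linarith

lemma le_of_potDiv_le' (hq0 : q ≠ 0) (hq1 : q ≠ 1) (ht : 0 < t) (γ : ℝ) :
    ∃ R, ∀ s ∈ potDom q, potDiv q s t ≤ γ → s ≤ R := by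
  have hp : 0 < potDiv q (t + 1) t :=
    potDiv_pos hq0 hq1 (mem_potDom_of_pos (by linarith)) ht (by linarith)
  refine ⟨max (t + 1) (t + γ / potDiv q (t + 1) t), fun s _ h => ?_⟩
  by_contra hlt
  rw [not_le, max_lt_iff] at hlt
  have h1 := potDiv_growth hq0 hq1 one_pos ht hlt.1.le
  have h2 : γ / potDiv q (t + 1) t < s - t := by linarith [hlt.2]
  rw [div_lt_iff₀ hp] at h2
  rw [div_one] at h1
  linarith

/-- Monotonicity of the second derivative when `q ≤ 2`. -/
lemma second_deriv_lower (hq2 : q ≤ 2) {R : ℝ} (ht : 0 < t) (htR : t ≤ R) :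
    |q| * R ^ (q - 2) ≤ |q| * t ^ (q - 2) :=
  mul_le_mul_of_nonneg_left (Real.rpow_le_rpow_of_nonpos ht htR (by linarith)) (abs_nonneg q)

/-- The divergence is bounded below off the diagonal when the second argument is bounded. -/
lemma exists_potDiv_ge (hq : 0 < q) (hq1 : q ≠ 1) {R d : ℝ} (hR : 0 < R) (hd : 0 < d) :
    ∃ ε > 0, ∀ s t, 0 ≤ s → 0 < t → t ≤ R → d ≤ |s - t| → ε ≤ potDiv q s t := by
  -- Points `s > R + d` reduce to `t + d`, because the divergence from `t` is no smaller beyond `t +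
  -- d`.
  suffices h : ∃ ε > 0, ∀ s t, 0 ≤ s → s ≤ R + d → 0 < t → t ≤ R → d ≤ |s - t| →
      ε ≤ potDiv q s t by
    obtain ⟨ε, hε, h⟩ := h
    refine ⟨ε, hε, fun s t hs ht htR hst => ?_⟩
    rcases le_or_gt s (R + d) with hsR | hsR
    · exact h s t hs hsR ht htR hst
    · refine (h (t + d) t (by linarith) (by linarith) ht htR ?_).trans
        (potDiv_le_of_le hq.ne' hq1 hd ht (by linarith))
      rw [add_sub_cancel_left, abs_of_pos hd]
  -- For `q < 1` the closed form may be singular at `t = 0`, but the second derivative is bounded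
  -- below on `(0, R + d]`. For `q > 1` the closed form is continuous and positive on a compact set
  -- that includes `t = 0`.
  rcases lt_or_gt_of_ne hq1 with hlt | hgt
  · have hpos : 0 < |q| * (R + d) ^ (q - 2) :=
      mul_pos (abs_pos.2 hq.ne') (Real.rpow_pos_of_pos (by linarith) _)
    refine ⟨|q| * (R + d) ^ (q - 2) / 2 * d ^ 2, by positivity, fun s t hs hsR ht htR hst => ?_⟩
    refine le_trans ?_ (potDiv_lower hq.ne' hq1 (μ := |q| * (R + d) ^ (q - 2))
      (by rwa [potDom_of_pos hq]) ht fun u hu hu0 => second_deriv_lower (by linarith) hu0 ?_)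
    · rw [← sq_abs (s - t)]
      gcongr
    · exact hu.2.trans (max_le hsR (by linarith))
  · set K : Set (ℝ × ℝ) := (Set.Icc 0 (R + d) ×ˢ Set.Icc 0 R) ∩ {p | d ≤ |p.1 - p.2|} with hK
    have hKc : IsCompact K := (isCompact_Icc.prod isCompact_Icc).inter_right
      (isClosed_le continuous_const (by fun_prop))
    have hne : K.Nonempty := ⟨(d, 0), by
      simp [hK, hd.le, hR.le, abs_of_pos hd]⟩
    have hcont : Continuous fun p : ℝ × ℝ =>
        coef q * (p.1 ^ q + (q - 1) * p.2 ^ q - q * p.1 * p.2 ^ (q - 1)) := by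
      have h1 := Real.continuous_rpow_const (q := q) hq.le
      have h2 := Real.continuous_rpow_const (q := q - 1) (by linarith)
      have h3 := h1.comp continuous_fst (Y := ℝ) (X := ℝ × ℝ)
      have h4 := h1.comp continuous_snd (Y := ℝ) (X := ℝ × ℝ)
      have h5 := h2.comp continuous_snd (Y := ℝ) (X := ℝ × ℝ)
      exact ((h3.add (h4.const_mul (q - 1))).sub
        ((continuous_fst.const_mul q).mul h5)).const_mul _
    obtain ⟨p, hp, hmin⟩ := hKc.exists_isMinOn hne hcont.continuousOn
    refine ⟨coef q * (p.1 ^ q + (q - 1) * p.2 ^ q - q * p.1 * p.2 ^ (q - 1)), ?_,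
      fun s t hs hsR ht htR hst => ?_⟩
    · obtain ⟨⟨⟨h1, -⟩, ⟨h2, -⟩⟩, h3⟩ := hp
      have h3 : d ≤ |p.1 - p.2| := h3
      rcases h2.eq_or_lt with h0 | h0
      · rw [← h0, Real.zero_rpow hq.ne', Real.zero_rpow (by linarith), coef, if_pos hq]
        rw [← h0, sub_zero, abs_of_nonneg h1] at h3
        have h4 : 0 < p.1 ^ q := Real.rpow_pos_of_pos (by linarith) _
        have h5 : 0 < q - 1 := by linarith
        simp only [mul_zero, add_zero, sub_zero]
        positivity
      · have := potDiv_pos hq.ne' hq1 (s := p.1) (by rwa [potDom_of_pos hq]) h0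
          fun h => by rw [h, sub_self, abs_zero] at h3; linarith
        rwa [potDiv_eq h0] at this
    · have : (s, t) ∈ K := ⟨⟨⟨hs, hsR⟩, ⟨ht.le, htR⟩⟩, hst⟩
      rw [potDiv_eq ht]
      exact hmin this

lemma continuousAt_dpot (ht : 0 < t) : ContinuousAt (dpot q) t :=
  ((Real.continuousAt_rpow_const t (q - 1) (Or.inl ht.ne')).const_mul q).const_mul _

/-- Consistency of the divergence, including at the boundary point `0`. -/
lemma tendsto_potDiv (hq : 0 < q) (hs : 0 ≤ s) {y : ℕ → ℝ} (hy : ∀ i, 0 < y i)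
    (h : Tendsto y atTop (𝓝 s)) : Tendsto (fun i => potDiv q s (y i)) atTop (𝓝 0) := by
  -- At `s = 0` the cross term containing `t ^ (q - 1)` disappears, so a singular derivative at the
  -- boundary does no harm.
  rcases hs.eq_or_lt with h0 | h0
  · subst h0
    have h1 : ∀ i, potDiv q 0 (y i) = coef q * ((q - 1) * y i ^ q) := fun i => by
      rw [potDiv_eq (hy i), Real.zero_rpow hq.ne']
      ring
    simp_rw [h1]
    have h2 := (Real.continuousAt_rpow_const 0 q (Or.inr hq.le)).tendsto.comp h
    have h3 := (h2.const_mul (q - 1)).const_mul (coef q)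
    simpa [Real.zero_rpow hq.ne'] using h3
  · have h1 := ((continuous_pot hq).tendsto s).comp h
    have h2 := (continuousAt_dpot (q := q) h0).tendsto.comp h
    have h3 := ((tendsto_const_nhds (x := pot q s)).sub h1).sub
      (h2.mul ((tendsto_const_nhds (x := s)).sub h))
    simpa [potDiv] using h3

/-! ### Upper bounds on convexity gaps; the divergence at infinity -/

/-- The convexity gap at the midpoint of `[s, s + 1]` vanishes at infinity when `q < 2`. -/
lemma pot_midpoint_gap_le (hq0 : q ≠ 0) (hq1 : q ≠ 1) (hq2 : q ≤ 2) (hs : 0 < s) :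
    1 / 2 * pot q (s + 1) + (1 - 1 / 2) * pot q s - pot q (1 / 2 * (s + 1) + (1 - 1 / 2) * s)
      ≤ |q| * s ^ (q - 2) := by
  -- Tangents at `s` and `s + 1` bound the gap by half the increment of the derivative, which the
  -- mean value theorem controls.
  have h1 := potDiv_nonneg (q := q) hq0 hq1 (s := 1 / 2 * (s + 1) + (1 - 1 / 2) * s)
    (mem_potDom_of_pos (by linarith)) hs
  have h2 := potDiv_nonneg (q := q) hq0 hq1 (s := s) (t := s + 1)
    (mem_potDom_of_pos hs) (by linarith)
  unfold potDiv at h1 h2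
  obtain ⟨c, hc, hc2⟩ := exists_hasDerivAt_eq_slope (dpot q) (fun t => |q| * t ^ (q - 2))
    (lt_add_one s)
    (fun t ht => (hasDerivAt_dpot hq0 hq1 (hs.trans_le ht.1)).continuousAt.continuousWithinAt)
    (fun t ht => hasDerivAt_dpot hq0 hq1 (hs.trans ht.1))
  have h3 := second_deriv_lower hq2 hs hc.1.le
  rw [add_sub_cancel_left, div_one] at hc2
  have h4 : 0 ≤ |q| * s ^ (q - 2) := by positivity
  nlinarith

/-- The gap is homogeneous of degree `q`, hence `o(s ^ 2)` at `0`; the midpoint term is negative and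
is dropped. -/
lemma pot_gap_le_of_two_lt (hq : 2 < q) (hs : 0 < s) :
    1 / 2 * pot q (2 * s) + (1 - 1 / 2) * pot q s - pot q (1 / 2 * (2 * s) + (1 - 1 / 2) * s)
      ≤ coef q * 2 ^ q * s ^ q := by
  have hc : 0 < coef q := by
    rw [coef, if_pos (by linarith)]
    exact one_div_pos.2 (by linarith)
  have h1 : (1 : ℝ) ≤ 2 ^ q := Real.one_le_rpow (by norm_num) (by linarith)
  have h2 : 0 < s ^ q := Real.rpow_pos_of_pos hs q
  have h3 : 0 < (1 / 2 * (2 * s) + (1 - 1 / 2) * s) ^ q := Real.rpow_pos_of_pos (by linarith) q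
  unfold pot
  rw [Real.mul_rpow (by norm_num) hs.le]
  have h4 : 0 ≤ coef q * ((2 ^ q - 1) * s ^ q) :=
    mul_nonneg hc.le (mul_nonneg (by linarith) h2.le)
  nlinarith [mul_pos hc h3]

/-- For `q < 0` the divergence stays bounded in its second argument. -/
lemma tendsto_potDiv_atTop (hq : q < 0) :
    Tendsto (fun t => potDiv q s t) atTop (𝓝 (s ^ q / (1 - q))) := by
  have h1 : Tendsto (fun t : ℝ => t ^ q) atTop (𝓝 0) := by
    simpa using tendsto_rpow_neg_atTop (neg_pos.2 hq)
  have h2 : Tendsto (fun t : ℝ => t ^ (q - 1)) atTop (𝓝 0) := by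
    simpa using tendsto_rpow_neg_atTop (neg_pos.2 (by linarith : q - 1 < 0))
  have h3 := (((h1.const_mul (q - 1)).const_add (s ^ q)).sub (h2.const_mul (q * s))).const_mul
    (coef q)
  have h4 : coef q * (s ^ q + (q - 1) * 0 - q * s * 0) = s ^ q / (1 - q) := by
    rw [coef, if_neg (by linarith)]
    ring
  rw [h4] at h3
  refine h3.congr' ?_
  filter_upwards [eventually_gt_atTop 0] with t ht
  rw [potDiv_eq ht]

end Potential

/-! ### Coordinates on a finite-dimensional normed space -/

section Vector

variable {X : Type*} [NormedAddCommGroup X] [NormedSpace ℝ X] {n : ℕ} {e : X ≃ₗ[ℝ] (Fin n → ℝ)}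
  {q : ℝ}

/-- The coordinate isomorphism as a continuous linear equivalence. -/
def coordCLE (e : X ≃ₗ[ℝ] (Fin n → ℝ)) : X ≃L[ℝ] (Fin n → ℝ) :=
  haveI := LinearEquiv.finiteDimensional e.symm
  e.toContinuousLinearEquiv

@[simp] lemma coordCLE_apply (x : X) : coordCLE e x = e x := rfl

@[simp] lemma coordCLE_symm_apply (v : Fin n → ℝ) : (coordCLE e).symm v = e.symm v := rfl

/-- The `k`-th coordinate as a continuous linear functional. -/
def coordFun (e : X ≃ₗ[ℝ] (Fin n → ℝ)) (k : Fin n) : X →L[ℝ] ℝ :=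
  (ContinuousLinearMap.proj k).comp (coordCLE e : X →L[ℝ] (Fin n → ℝ))

@[simp] lemma coordFun_apply (k : Fin n) (x : X) : coordFun e k x = e x k := rfl

lemma abs_coord_le (e : X ≃ₗ[ℝ] (Fin n → ℝ)) (v : X) (k : Fin n) :
    |e v k| ≤ ‖(coordCLE e : X →L[ℝ] (Fin n → ℝ))‖ * ‖v‖ :=
  (norm_le_pi_norm (e v) k).trans ((coordCLE e : X →L[ℝ] (Fin n → ℝ)).le_opNorm v)

lemma norm_le_of_abs_coord_le (e : X ≃ₗ[ℝ] (Fin n → ℝ)) {v : X} {R : ℝ} (hR : 0 ≤ R)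
    (h : ∀ k, |e v k| ≤ R) :
    ‖v‖ ≤ ‖((coordCLE e).symm : (Fin n → ℝ) →L[ℝ] X)‖ * R := by
  have h1 := ((coordCLE e).symm : (Fin n → ℝ) →L[ℝ] X).le_opNorm (e v)
  have h2 : ((coordCLE e).symm : (Fin n → ℝ) →L[ℝ] X) (e v) = v := e.symm_apply_apply v
  rw [h2] at h1
  exact h1.trans (mul_le_mul_of_nonneg_left ((pi_norm_le_iff_of_nonneg hR).2 h) (norm_nonneg _))

lemma isBounded_of_coord (e : X ≃ₗ[ℝ] (Fin n → ℝ)) {S : Set X}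
    (h : ∀ k, ∃ R, ∀ x ∈ S, |e x k| ≤ R) : Bornology.IsBounded S := by
  choose R hR using h
  rw [isBounded_iff_forall_norm_le]
  refine ⟨_, fun x hx => norm_le_of_abs_coord_le e (R := ∑ k, |R k|) (by positivity) fun k => ?_⟩
  exact ((hR k x hx).trans (le_abs_self _)).trans
    (Finset.single_le_sum (f := fun k => |R k|) (fun i _ => abs_nonneg _) (Finset.mem_univ k))

lemma tendsto_of_coord (e : X ≃ₗ[ℝ] (Fin n → ℝ)) {x : ℕ → X} {z : X}
    (h : ∀ k, Tendsto (fun i => e (x i) k) atTop (𝓝 (e z k))) : Tendsto x atTop (𝓝 z) := by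
  have h1 : Tendsto (fun i => e (x i)) atTop (𝓝 (e z)) := tendsto_pi_nhds.2 h
  simpa [Function.comp_def] using ((coordCLE e).symm.continuous.tendsto (e z)).comp h1

lemma exists_areNormConstants (e : X ≃ₗ[ℝ] (Fin n → ℝ)) :
    ∃ c₂ cinf : ℝ, AreNormConstants e c₂ cinf := by
  set A := ‖(coordCLE e : X →L[ℝ] (Fin n → ℝ))‖ with hA
  set B := ‖((coordCLE e).symm : (Fin n → ℝ) →L[ℝ] X)‖ with hB
  have hA0 : 0 ≤ A := norm_nonneg _
  have hB0 : 0 ≤ B := norm_nonneg _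
  -- Adding `1` keeps both constants positive even if the operator norms vanish.
  refine ⟨1 / (B + 1), A + 1, by positivity, by positivity, fun v => ?_, fun v k => ?_⟩
  · have h := norm_le_of_abs_coord_le e (v := v) (R := Real.sqrt (∑ k, (e v k) ^ 2))
      (Real.sqrt_nonneg _) fun k => by
        rw [← Real.sqrt_sq_eq_abs]
        exact Real.sqrt_le_sqrt (Finset.single_le_sum (f := fun k => (e v k) ^ 2)
          (fun i _ => sq_nonneg _) (Finset.mem_univ k))
    rw [one_div_mul_eq_div, div_le_iff₀ (by positivity)]
    nlinarith [Real.sqrt_nonneg (∑ k, (e v k) ^ 2)]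
  · have h := abs_coord_le e v k
    nlinarith [norm_nonneg v]

lemma AreNormConstants.sq_le {c₂ cinf : ℝ} (h : AreNormConstants e c₂ cinf) (v : X) :
    c₂ ^ 2 * ‖v‖ ^ 2 ≤ ∑ k, (e v k) ^ 2 := by
  have h1 := h.2.2.1 v
  have h2 : 0 ≤ ∑ k, (e v k) ^ 2 := Finset.sum_nonneg fun k _ => sq_nonneg _
  rw [← mul_pow, ← Real.sq_sqrt h2]
  exact pow_le_pow_left₀ (mul_nonneg h.1.le (norm_nonneg v)) h1 2

/-! ### The Tsallis entropy in coordinates -/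

/-- The real-valued separable function underlying `tsallis`. -/
def sumPot (e : X ≃ₗ[ℝ] (Fin n → ℝ)) (q : ℝ) (x : X) : ℝ := ∑ k, pot q (e x k)

lemma tsallis_of_mem {x : X} (h : ∀ k, e x k ∈ potDom q) :
    tsallis e q x = (sumPot e q x : EReal) := by
  unfold potDom at h
  unfold tsallis sumPot pot coef
  split_ifs at h ⊢ with h1 h2 h2
  · rw [Finset.mul_sum]
  · exact absurd h h2
  · rw [Finset.mul_sum]
  · exact absurd h h2

lemma tsallis_of_notMem {x : X} (h : ¬ ∀ k, e x k ∈ potDom q) : tsallis e q x = ⊤ := by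
  unfold potDom at h
  unfold tsallis
  split_ifs at h ⊢ with h1 h2 h2
  · exact absurd h2 h
  · rfl
  · exact absurd h2 h
  · rfl

lemma mem_dom_iff {x : X} : x ∈ dom (tsallis e q) ↔ ∀ k, e x k ∈ potDom q := by
  by_cases h : ∀ k, e x k ∈ potDom q
  · simp [dom, tsallis_of_mem h, h]
  · simp [dom, tsallis_of_notMem h, h]

lemma tsallis_of_mem_dom {x : X} (h : x ∈ dom (tsallis e q)) :
    tsallis e q x = (sumPot e q x : EReal) := tsallis_of_mem (mem_dom_iff.1 h)

lemma tsallis_ne_bot (x : X) : tsallis e q x ≠ ⊥ := by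
  by_cases h : ∀ k, e x k ∈ potDom q
  · simp [tsallis_of_mem h]
  · simp [tsallis_of_notMem h]

lemma dom_eq_preimage : dom (tsallis e q) =
    (coordCLE e).toHomeomorph ⁻¹' Set.pi Set.univ fun _ => potDom q := by
  ext x
  simp [mem_dom_iff]

lemma orthant_eq_preimage : orthant e =
    (coordCLE e).toHomeomorph ⁻¹' Set.pi Set.univ fun _ => Set.Ioi 0 := by
  ext x
  simp [orthant]

lemma interior_dom : interior (dom (tsallis e q)) = orthant e := by
  rw [dom_eq_preimage, orthant_eq_preimage, ← Homeomorph.preimage_interior,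
    interior_pi_set Set.finite_univ]
  simp_rw [interior_potDom]

lemma isOpen_orthant : IsOpen (orthant e) := by
  rw [← interior_dom (q := 1)]
  exact isOpen_interior

lemma closure_orthant : closure (orthant e) = {x | ∀ k, 0 ≤ e x k} := by
  rw [orthant_eq_preimage, ← Homeomorph.preimage_closure, closure_pi_set]
  ext x
  simp [Pi.le_def]

lemma orthant_subset_dom : orthant e ⊆ dom (tsallis e q) :=
  fun _ hx => mem_dom_iff.2 fun k => mem_potDom_of_pos (hx k)

lemma convex_dom {x y : X} (hx : x ∈ dom (tsallis e q)) (hy : y ∈ dom (tsallis e q)) {t : ℝ}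
    (ht : t ∈ Set.Ioo (0 : ℝ) 1) : t • x + (1 - t) • y ∈ dom (tsallis e q) := by
  rw [mem_dom_iff] at *
  intro k
  have := convex_potDom (hx k) (hy k) ht.1.le (sub_nonneg.2 ht.2.le) (by ring)
  simpa using this

lemma coord_comb (x y : X) (t : ℝ) (k : Fin n) :
    e (t • x + (1 - t) • y) k = t * e x k + (1 - t) * e y k := by simp

/-- Strong convexity between two points, in coordinates. -/
lemma sumPot_gap (hq0 : q ≠ 0) (hq1 : q ≠ 1) {x y : X} {μ a c₂ cinf : ℝ}
    (hc : AreNormConstants e c₂ cinf)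
    (hx : x ∈ dom (tsallis e q)) (hy : y ∈ dom (tsallis e q)) (hμ0 : 0 ≤ μ)
    (hμ : ∀ k, ∀ t ∈ Set.uIcc (e x k) (e y k), 0 < t → μ ≤ |q| * t ^ (q - 2))
    (ha : a ∈ Set.Ioo (0 : ℝ) 1) :
    sumPot e q (a • x + (1 - a) • y) + a * (1 - a) * (1 / 2 * (μ * c₂ ^ 2) * ‖x - y‖ ^ 2)
      ≤ a * sumPot e q x + (1 - a) * sumPot e q y := by
  have h1 : ∑ k, (pot q (a * e x k + (1 - a) * e y k)
      + a * (1 - a) * (μ / 2 * (e x k - e y k) ^ 2)) ≤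
      ∑ k, (a * pot q (e x k) + (1 - a) * pot q (e y k)) :=
    Finset.sum_le_sum fun k _ =>
      pot_gap hq0 hq1 (mem_dom_iff.1 hx k) (mem_dom_iff.1 hy k) (hμ k) ha
  simp only [Finset.sum_add_distrib, ← Finset.mul_sum] at h1
  simp only [sumPot, coord_comb]
  have h2 := hc.sq_le (x - y)
  simp only [map_sub, Pi.sub_apply] at h2
  have h3 : a * (1 - a) * (1 / 2 * (μ * c₂ ^ 2) * ‖x - y‖ ^ 2)
      ≤ a * (1 - a) * (μ / 2 * ∑ k, (e x k - e y k) ^ 2) := by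
    have : 0 ≤ a * (1 - a) := mul_nonneg ha.1.le (sub_nonneg.2 ha.2.le)
    refine mul_le_mul_of_nonneg_left ?_ this
    calc _ = μ / 2 * (c₂ ^ 2 * ‖x - y‖ ^ 2) := by ring
      _ ≤ _ := mul_le_mul_of_nonneg_left h2 (by positivity)
  linarith

lemma sumPot_convex (hq0 : q ≠ 0) (hq1 : q ≠ 1) {x y : X} {a : ℝ}
    (hx : x ∈ dom (tsallis e q)) (hy : y ∈ dom (tsallis e q)) (ha : a ∈ Set.Ioo (0 : ℝ) 1) :
    sumPot e q (a • x + (1 - a) • y) ≤ a * sumPot e q x + (1 - a) * sumPot e q y := by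
  obtain ⟨c₂, cinf, hc⟩ := exists_areNormConstants e
  simpa using sumPot_gap hq0 hq1 hc hx hy le_rfl (fun k t _ ht => by positivity) ha

lemma sumPot_strictConvex (hq0 : q ≠ 0) (hq1 : q ≠ 1) {x y : X} {a : ℝ}
    (hx : x ∈ dom (tsallis e q)) (hy : y ∈ dom (tsallis e q)) (hxy : x ≠ y)
    (ha : a ∈ Set.Ioo (0 : ℝ) 1) :
    sumPot e q (a • x + (1 - a) • y) < a * sumPot e q x + (1 - a) * sumPot e q y := by
  simp only [sumPot, coord_comb, Finset.mul_sum, ← Finset.sum_add_distrib]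
  have hs := strictConvexOn_pot hq0 hq1
  obtain ⟨k, hk⟩ : ∃ k, e x k ≠ e y k := by
    by_contra! h
    exact hxy (e.injective (funext h))
  refine Finset.sum_lt_sum (fun j _ => ?_) ⟨k, Finset.mem_univ k, ?_⟩
  · exact hs.convexOn.2 (mem_dom_iff.1 hx j) (mem_dom_iff.1 hy j) ha.1.le
      (sub_nonneg.2 ha.2.le) (by ring)
  · exact hs.2 (mem_dom_iff.1 hx k) (mem_dom_iff.1 hy k) hk ha.1 (sub_pos.2 ha.2) (by ring)

lemma isConvex_tsallis (hq0 : q ≠ 0) (hq1 : q ≠ 1) : IsConvex (tsallis e q) := by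
  intro x y t ht
  have ht' : 0 < 1 - t := sub_pos.2 ht.2
  by_cases hx : x ∈ dom (tsallis e q)
  · by_cases hy : y ∈ dom (tsallis e q)
    · rw [tsallis_of_mem_dom hx, tsallis_of_mem_dom hy, tsallis_of_mem_dom (convex_dom hx hy ht)]
      exact_mod_cast sumPot_convex hq0 hq1 hx hy ht
    · rw [tsallis_of_notMem (mt mem_dom_iff.2 hy), EReal.coe_mul_top_of_pos ht',
        tsallis_of_mem_dom hx, ← EReal.coe_mul, EReal.coe_add_top]
      exact le_top
  · rw [tsallis_of_notMem (mt mem_dom_iff.2 hx), EReal.coe_mul_top_of_pos ht.1]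
    -- In `EReal` one has `⊤ + ⊥ = ⊥`, so the second summand must be shown not to be `⊥`.
    rw [EReal.top_add_of_ne_bot]
    · exact le_top
    · by_cases hy : y ∈ dom (tsallis e q)
      · rw [tsallis_of_mem_dom hy, ← EReal.coe_mul]
        exact EReal.coe_ne_bot _
      · rw [tsallis_of_notMem (mt mem_dom_iff.2 hy), EReal.coe_mul_top_of_pos ht']
        exact top_ne_bot

lemma isStrictlyConvexOn_tsallis (hq0 : q ≠ 0) (hq1 : q ≠ 1) :
    IsStrictlyConvexOn (tsallis e q) (dom (tsallis e q)) := by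
  intro x hx y hy hxy t ht
  rw [tsallis_of_mem_dom hx, tsallis_of_mem_dom hy, tsallis_of_mem_dom (convex_dom hx hy ht)]
  exact_mod_cast sumPot_strictConvex hq0 hq1 hx hy hxy ht

/-- The gauge inequality for a finite value of the gauge. -/
lemma gauge_ineq_iff {x y : X} (hx : x ∈ dom (tsallis e q)) (hy : y ∈ dom (tsallis e q))
    {t c : ℝ} (ht : t ∈ Set.Ioo (0 : ℝ) 1) (hc : 0 ≤ c) :
    (tsallis e q (t • x + (1 - t) • y) + ((t * (1 - t) : ℝ) : EReal) * (ENNReal.ofReal c : EReal)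
      ≤ (t : EReal) * tsallis e q x + ((1 - t : ℝ) : EReal) * tsallis e q y) ↔
    sumPot e q (t • x + (1 - t) • y) + t * (1 - t) * c
      ≤ t * sumPot e q x + (1 - t) * sumPot e q y := by
  rw [tsallis_of_mem_dom hx, tsallis_of_mem_dom hy, tsallis_of_mem_dom (convex_dom hx hy ht),
    EReal.coe_ennreal_ofReal, max_eq_left hc]
  norm_cast

/-- A finite lower bound for a gauge gives a real inequality. -/
lemma IsRelativeGauge.real_ineq {S₁ S₂ : Set X} {ψ : ℝ≥0 → ℝ≥0∞}
    (h : IsRelativeGauge (tsallis e q) S₁ S₂ ψ) (h₁ : S₁ ⊆ dom (tsallis e q))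
    (h₂ : S₂ ⊆ dom (tsallis e q)) {x y : X} (hx : x ∈ S₁) (hy : y ∈ S₂)
    {t c : ℝ} (ht : t ∈ Set.Ioo (0 : ℝ) 1) (hc : 0 ≤ c) (hcψ : ENNReal.ofReal c ≤ ψ ‖x - y‖₊) :
    sumPot e q (t • x + (1 - t) • y) + t * (1 - t) * c
      ≤ t * sumPot e q x + (1 - t) * sumPot e q y := by
  rw [← gauge_ineq_iff (h₁ hx) (h₂ hy) ht hc]
  refine le_trans ?_ (h.2 x hx y hy t ht)
  have h0 : (0 : EReal) ≤ ((t * (1 - t) : ℝ) : EReal) := by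
    exact_mod_cast mul_nonneg ht.1.le (sub_nonneg.2 ht.2.le)
  gcongr
  exact_mod_cast hcψ

/-- Common source of all the strong convexity parameters. Only coordinate intervals between points
of `S` matter, so `S` need not be convex. -/
lemma isStrongConvexityParameter_of_bound (hq0 : q ≠ 0) (hq1 : q ≠ 1) {c₂ cinf μ : ℝ}
    (hc : AreNormConstants e c₂ cinf) (hμ0 : 0 < μ) {S : Set X} (hS : S ⊆ dom (tsallis e q))
    (hμ : ∀ x ∈ S, ∀ y ∈ S, ∀ k, ∀ t ∈ Set.uIcc (e x k) (e y k), 0 < t →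
      μ ≤ |q| * t ^ (q - 2)) :
    IsStrongConvexityParameter (tsallis e q) S (μ * c₂ ^ 2) := by
  have hc2 := hc.1
  refine ⟨by positivity, fun r hr => ?_, fun x hx y hy t ht => ?_⟩
  · have : (0 : ℝ) < r := hr
    rw [ENNReal.ofReal_pos]
    positivity
  · rw [gauge_ineq_iff (hS hx) (hS hy) ht (by positivity)]
    exact sumPot_gap hq0 hq1 hc (hS hx) (hS hy) hμ0.le (hμ x hx y hy) ht

/-! ### Differentiability and the divergence -/

/-- The derivative of `tsallis e q` at `y`. -/
def gradPot (e : X ≃ₗ[ℝ] (Fin n → ℝ)) (q : ℝ) (y : X) : X →L[ℝ] ℝ :=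
  ∑ k, dpot q (e y k) • coordFun e k

lemma gradPot_apply (y v : X) : gradPot e q y v = ∑ k, dpot q (e y k) * e v k := by
  simp [gradPot]

lemma hasGateauxDerivAt_tsallis {y : X} (hy : y ∈ orthant e) :
    HasGateauxDerivAt (tsallis e q) (gradPot e q y) y := by
  refine ⟨by rwa [interior_dom], fun v => ?_⟩
  have h1 : HasDerivAt (fun t : ℝ => sumPot e q (y + t • v)) (gradPot e q y v) 0 := by
    rw [gradPot_apply]
    unfold sumPot
    refine HasDerivAt.fun_sum fun k _ => ?_
    have h2 : HasDerivAt (fun t : ℝ => e (y + t • v) k) (e v k) 0 := by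
      have := ((hasDerivAt_id (0 : ℝ)).mul_const (e v k)).const_add (e y k)
      simpa using this
    have h3 : HasDerivAt (pot q) (dpot q (e y k)) (e (y + (0 : ℝ) • v) k) := by
      simpa using hasDerivAt_pot (q := q) (hy k)
    exact HasDerivAt.comp (h₂ := pot q) 0 h3 h2
  refine h1.congr_of_eventuallyEq ?_
  have h4 : Tendsto (fun t : ℝ => y + t • v) (𝓝 0) (𝓝 y) := by
    have : Continuous fun t : ℝ => y + t • v := by fun_prop
    simpa using this.tendsto 0
  filter_upwards [h4.eventually (isOpen_orthant.mem_nhds hy)] with t ht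
  rw [tsallis_of_mem_dom (orthant_subset_dom ht), EReal.toReal_coe]

lemma gateauxDeriv_tsallis {y : X} (hy : y ∈ orthant e) :
    gateauxDeriv (tsallis e q) y = gradPot e q y := by
  have h : ∃ L : X →L[ℝ] ℝ, HasGateauxDerivAt (tsallis e q) L y :=
    ⟨_, hasGateauxDerivAt_tsallis hy⟩
  rw [gateauxDeriv, dif_pos h]
  ext v
  exact (h.choose_spec.2 v).unique ((hasGateauxDerivAt_tsallis hy).2 v)

/-- The divergence in coordinates. -/
def sumDiv (e : X ≃ₗ[ℝ] (Fin n → ℝ)) (q : ℝ) (x y : X) : ℝ := ∑ k, potDiv q (e x k) (e y k)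

lemma sumDiv_eq (x y : X) :
    sumDiv e q x y = sumPot e q x - sumPot e q y - gradPot e q y (x - y) := by
  simp [sumDiv, potDiv, sumPot, gradPot_apply, Finset.sum_sub_distrib]

lemma divergence_tsallis {x y : X} (hx : x ∈ dom (tsallis e q)) (hy : y ∈ orthant e) :
    divergence (tsallis e q) x y = (sumDiv e q x y : EReal) := by
  rw [divergence, if_pos ⟨hx, by rwa [interior_dom]⟩, gateauxDeriv_tsallis hy,
    tsallis_of_mem_dom hx, tsallis_of_mem_dom (orthant_subset_dom hy), EReal.toReal_coe,
    EReal.toReal_coe, sumDiv_eq]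

lemma potDiv_le_sumDiv (hq0 : q ≠ 0) (hq1 : q ≠ 1) {x y : X} (hx : x ∈ dom (tsallis e q))
    (hy : y ∈ orthant e) (k : Fin n) : potDiv q (e x k) (e y k) ≤ sumDiv e q x y :=
  Finset.single_le_sum (f := fun k => potDiv q (e x k) (e y k))
    (fun j _ => potDiv_nonneg hq0 hq1 (mem_dom_iff.1 hx j) (hy j)) (Finset.mem_univ k)

lemma one_mem_orthant : e.symm 1 ∈ orthant e := fun k => by simp

lemma isPreBregman_tsallis : IsPreBregman (tsallis e q) where
  ne_bot := tsallis_ne_bot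
  nonempty := ⟨e.symm 1, by rw [interior_dom]; exact one_mem_orthant⟩
  differentiable y hy := ⟨_, hasGateauxDerivAt_tsallis (by rwa [interior_dom] at hy)⟩

/-! ### Strong convexity and relative gauges -/

lemma coord_le_of_norm_le {c₂ cinf : ℝ} (hc : AreNormConstants e c₂ cinf) {x : X} {M : ℝ}
    (hx : ‖x‖ ≤ M) (k : Fin n) : e x k ≤ cinf * M :=
  (le_abs_self _).trans ((hc.2.2.2 x k).trans (mul_le_mul_of_nonneg_left hx hc.2.1.le))

lemma strongConvexity_of_bounded (hq0 : q ≠ 0) (hq1 : q ≠ 1) (hq2 : q < 2) {c₂ cinf : ℝ}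
    (hc : AreNormConstants e c₂ cinf) {S : Set X} (hS : S ⊆ dom (tsallis e q)) {M : ℝ}
    (hM : 0 < M) (hSM : ∀ s ∈ S, ‖s‖ ≤ M) :
    IsStrongConvexityParameter (tsallis e q) S (|q| * c₂ ^ 2 / (cinf * M) ^ (2 - q)) := by
  have hcM : 0 < cinf * M := mul_pos hc.2.1 hM
  have h := isStrongConvexityParameter_of_bound hq0 hq1 hc (μ := |q| * (cinf * M) ^ (q - 2))
    (mul_pos (abs_pos.2 hq0) (Real.rpow_pos_of_pos hcM _)) hS
    fun x hx y hy k t ht ht0 => second_deriv_lower hq2.le ht0 (ht.2.trans (max_le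
      (coord_le_of_norm_le hc (hSM x hx) k) (coord_le_of_norm_le hc (hSM y hy) k)))
  rw [← neg_sub 2 q, Real.rpow_neg hcM.le] at h
  convert h using 1
  ring

/-- All coordinates involved are at most `cinf * ‖y‖`, and `‖y‖ ≤ 2 * ‖x - y‖` by the triangle
inequality. The curvature bound is thus a multiple of `‖x - y‖ ^ (q - 2)`, which times `‖x - y‖ ^ 2`
gives the power `q`. -/
lemma relativeGauge_tsallis (hq0 : q ≠ 0) (hq1 : q ≠ 1) (hq2 : q < 2) {c₂ cinf : ℝ}
    (hc : AreNormConstants e c₂ cinf) {x : X} (hx : x ∈ dom (tsallis e q)) :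
    IsRelativeGauge (tsallis e q) {x} (orthant e ∩ {w | 2 * ‖x‖ < ‖w‖})
      (tsallisGauge q c₂ cinf) := by
  have hc2 := hc.1
  have hci := hc.2.1
  have hq := abs_pos.2 hq0
  refine ⟨fun r hr => ?_, ?_⟩
  · have : (0 : ℝ) < r := hr
    rw [tsallisGauge, if_neg hr.ne', ENNReal.ofReal_pos]
    positivity
  · rintro z rfl y ⟨hy, hzy⟩ t ht
    have hzy : 2 * ‖z‖ < ‖y‖ := hzy
    have hyd : y ∈ dom (tsallis e q) := orthant_subset_dom hy
    have hy0 : 0 < ‖y‖ := lt_of_le_of_lt (by positivity) hzy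
    have hr : ‖y‖ ≤ 2 * ‖z - y‖ := by
      have := norm_sub_norm_le y z
      rw [norm_sub_rev] at this
      linarith
    have hr0 : 0 < ‖z - y‖ := by linarith
    have hne : ‖z - y‖₊ ≠ 0 := (show (0 : ℝ≥0) < ‖z - y‖₊ from hr0).ne'
    have hcy : 0 < cinf * ‖y‖ := mul_pos hci hy0
    rw [tsallisGauge, if_neg hne, gauge_ineq_iff hx hyd ht (by positivity), coe_nnnorm]
    have h := sumPot_gap hq0 hq1 hc hx hyd (μ := |q| * (cinf * ‖y‖) ^ (q - 2)) (by positivity)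
      (fun k u hu hu0 => second_deriv_lower hq2.le hu0 (hu.2.trans (max_le
        (coord_le_of_norm_le hc (by linarith [norm_nonneg z]) k)
        (coord_le_of_norm_le hc le_rfl k)))) ht
    refine le_trans ?_ h
    have ht' : 0 ≤ t * (1 - t) := mul_nonneg ht.1.le (sub_nonneg.2 ht.2.le)
    refine add_le_add le_rfl (mul_le_mul_of_nonneg_left ?_ ht')
    set r := ‖z - y‖ with hrdef
    have h1 : (cinf * (2 * r)) ^ (q - 2) ≤ (cinf * ‖y‖) ^ (q - 2) :=
      Real.rpow_le_rpow_of_nonpos hcy (mul_le_mul_of_nonneg_left hr hci.le) (by linarith)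
    have h2 : |q| * c₂ ^ 2 / (cinf ^ (2 - q) * 2 ^ (3 - q)) * r ^ q
        = 1 / 2 * (|q| * (cinf * (2 * r)) ^ (q - 2) * c₂ ^ 2) * r ^ 2 := by
      rw [Real.mul_rpow hci.le (by positivity), Real.mul_rpow (by norm_num) hr0.le,
        show (3 : ℝ) - q = (2 - q) + 1 by ring, Real.rpow_add_one (by norm_num),
        show q - 2 = -(2 - q) by ring, Real.rpow_neg hci.le, Real.rpow_neg (by norm_num),
        show r ^ q = r ^ (-(2 - q)) * r ^ 2 by
          rw [← Real.rpow_natCast r 2, ← Real.rpow_add hr0]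
          congr 1
          push_cast
          ring]
      field_simp
    rw [h2]
    gcongr

lemma strongConvexity_two {c₂ cinf : ℝ} (hc : AreNormConstants e c₂ cinf) :
    IsStrongConvexityParameter (tsallis e 2) (dom (tsallis e 2)) (2 * c₂ ^ 2) :=
  isStrongConvexityParameter_of_bound (by norm_num) (by norm_num) hc two_pos subset_rfl
    fun x _ y _ k t _ _ => by simp

lemma strongConvexity_of_ge (hq2 : 2 < q) {c₂ cinf : ℝ} (hc : AreNormConstants e c₂ cinf) {ε : ℝ}
    (hε : 0 < ε) {V : Set X} (hV : ∀ z ∈ V, ∀ k, ε ≤ e z k) :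
    IsStrongConvexityParameter (tsallis e q) V (q * c₂ ^ 2 * ε ^ (q - 2)) := by
  have hq : 0 < q := by linarith
  have h := isStrongConvexityParameter_of_bound hq.ne' (by linarith) hc
    (mul_pos hq (Real.rpow_pos_of_pos hε (q - 2))) (S := V)
    (fun z hz => orthant_subset_dom fun k => hε.trans_le (hV z hz k))
    fun x hx y hy k t ht ht0 => by
      rw [abs_of_pos hq]
      exact mul_le_mul_of_nonneg_left (Real.rpow_le_rpow hε.le
        ((le_min (hV x hx k) (hV y hy k)).trans ht.1) (by linarith)) hq.le
  convert h using 1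
  ring

lemma update_zero_mem_frontier {z : X} (hz : z ∈ orthant e) (k : Fin n) :
    e.symm (Function.update (e z) k 0) ∈ frontier (orthant e) := by
  rw [frontier, closure_orthant, isOpen_orthant.interior_eq]
  refine ⟨fun j => ?_, fun h => ?_⟩
  · rw [LinearEquiv.apply_symm_apply]
    rcases eq_or_ne j k with rfl | hj
    · simp
    · simpa [hj] using (hz j).le
  · have := h k
    simp at this

/-- Setting the `k`-th coordinate of `z` to zero reaches the boundary at distance at most `B * e z
k`, so every coordinate is at least `δ / (B + 1)`. -/
lemma stronglyConvex_of_dist (hq2 : 2 < q) {V : Set X} (hV : V ⊆ orthant e) {δ : ℝ} (hδ : 0 < δ)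
    (h : ∀ z ∈ V, ∀ w ∈ frontier (orthant e), δ ≤ ‖z - w‖) :
    IsStronglyConvexOn (tsallis e q) V := by
  obtain ⟨c₂, cinf, hc⟩ := exists_areNormConstants e
  set B := ‖((coordCLE e).symm : (Fin n → ℝ) →L[ℝ] X)‖ with hB
  have hB0 : 0 ≤ B := norm_nonneg _
  refine ⟨_, strongConvexity_of_ge hq2 hc (ε := δ / (B + 1)) (by positivity) fun z hz k => ?_⟩
  have h1 := h z hz _ (update_zero_mem_frontier (hV hz) k)
  have hzk : 0 < e z k := hV hz k
  have h2 := norm_le_of_abs_coord_le e (v := z - e.symm (Function.update (e z) k 0))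
    hzk.le fun j => by
      rcases eq_or_ne j k with rfl | hj
      · simp [abs_of_pos hzk]
      · simp [hj, hzk.le]
  rw [div_le_iff₀ (by positivity)]
  nlinarith

/-! ### Failure of strong and uniform convexity -/

/-- Move a pair with fixed difference `(1, …, 1)` to infinity along the diagonal: the midpoint gap
tends to `0`, while a gauge would keep it above a positive constant. -/
lemma not_uniformlyConvex (hn : 0 < n) (hq0 : q ≠ 0) (hq1 : q ≠ 1) (hq2 : q < 2) :
    ¬ IsUniformlyConvexOn (tsallis e q) (orthant e) := by
  rintro ⟨ψ, hψ⟩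
  have hne : e.symm 1 ≠ 0 := by
    rw [Ne, LinearEquiv.map_eq_zero_iff]
    intro h
    simpa using congrFun h ⟨0, hn⟩
  set r := ‖e.symm 1‖₊ with hr
  have hr0 : 0 < r := nnnorm_pos.2 hne
  -- The gauge value may be infinite, so a finite positive lower bound replaces it.
  obtain ⟨c, hc0, hcψ⟩ := ENNReal.lt_iff_exists_nnreal_btwn.1 (hψ.1 r hr0)
  have hc0 : 0 < c := by exact_mod_cast hc0
  have hkey : ∀ s : ℝ, 0 < s → 1 / 4 * (c : ℝ) ≤ n * (|q| * s ^ (q - 2)) := by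
    intro s hs
    have hx : e.symm (fun _ => s + 1) ∈ orthant e := fun k => by simp; linarith
    have hy : e.symm (fun _ => s) ∈ orthant e := fun k => by simpa using hs
    have hxy : e.symm (fun _ => s + 1) - e.symm (fun _ => s) = e.symm 1 := by
      rw [← map_sub]
      congr 1
      ext
      simp
    have h := hψ.real_ineq orthant_subset_dom orthant_subset_dom hx hy (t := 1 / 2) (c := c)
      (by norm_num) c.2 (by rw [hxy, ENNReal.ofReal_coe_nnreal]; exact hcψ.le)
    simp only [sumPot, coord_comb, LinearEquiv.apply_symm_apply, Finset.sum_const,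
      Finset.card_univ, Fintype.card_fin, nsmul_eq_mul] at h
    have h2 := mul_le_mul_of_nonneg_left (pot_midpoint_gap_le hq0 hq1 hq2.le hs)
      (Nat.cast_nonneg (α := ℝ) n)
    linarith
  have hl : Tendsto (fun s : ℝ => n * (|q| * s ^ (q - 2))) atTop (𝓝 0) := by
    have := tendsto_rpow_neg_atTop (y := 2 - q) (by linarith)
    simpa using (this.const_mul |q|).const_mul (n : ℝ)
  have h3 := ge_of_tendsto hl ((eventually_gt_atTop 0).mono hkey)
  have : (0 : ℝ) < c := hc0
  linarith

/-- Test points with `k`-th coordinates `2 * s` and `s`: strong convexity forces a gap of order `s ^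
2`, but it is at most of order `s ^ q`. -/
lemma not_stronglyConvex_interval (hq2 : 2 < q) (k : Fin n) {a : ℝ} (ha : 0 < a) :
    ¬ IsStronglyConvexOn (tsallis e q)
      (segment ℝ (e.symm (Function.update 1 k a)) (e.symm (Function.update 1 k 0)) \
        {e.symm (Function.update 1 k 0)}) := by
  rintro ⟨μ, hμ, hg⟩
  set S := segment ℝ (e.symm (Function.update 1 k a)) (e.symm (Function.update 1 k 0)) \
        {e.symm (Function.update 1 k 0)} with hS
  set p : ℝ → X := fun s => e.symm (Function.update 1 k s) with hp
  have hcoord : ∀ s j, e (p s) j = if j = k then s else 1 := fun s j => by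
    simp [hp, Function.update_apply]
  have hmem : ∀ s, 0 < s → s ≤ a → p s ∈ S := by
    intro s hs hsa
    refine ⟨⟨s / a, 1 - s / a, by positivity, sub_nonneg.2 ((div_le_one ha).2 hsa), by ring,
      e.injective (funext fun j => ?_)⟩, fun h => ?_⟩
    · rw [coord_comb, hcoord a j, hcoord 0 j, hcoord s j]
      split_ifs
      · field_simp
        ring
      · ring
    · have := congrFun (congrArg e h) k
      rw [hcoord s k] at this
      simp at this
      linarith
  have hdom : S ⊆ dom (tsallis e q) := by
    rintro _ ⟨⟨b, c, hb, hc, hbc, rfl⟩, -⟩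
    rw [mem_dom_iff, potDom_of_pos (by linarith)]
    intro j
    obtain rfl : c = 1 - b := by linarith
    rw [coord_comb, hcoord a j, hcoord 0 j]
    have : (0 : ℝ) ≤ if j = k then a else 1 := by split_ifs <;> linarith
    have : (0 : ℝ) ≤ if j = k then 0 else 1 := by split_ifs <;> norm_num
    exact Set.mem_Ici.2 (by positivity)
  set D := ‖e.symm (Pi.single k 1)‖ with hD
  have hD0 : 0 < D := by
    rw [hD, norm_pos_iff, Ne, LinearEquiv.map_eq_zero_iff]
    simp
  have hkey : ∀ s : ℝ, 0 < s → 2 * s ≤ a →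
      1 / 8 * μ * D ^ 2 ≤ coef q * 2 ^ q * s ^ (q - 2) := by
    intro s hs hsa
    have hdist : ‖p (2 * s) - p s‖ = s * D := by
      have : p (2 * s) - p s = s • e.symm (Pi.single k 1) := by
        apply e.injective
        ext j
        rw [map_sub, Pi.sub_apply, hcoord, hcoord, map_smul, Pi.smul_apply,
          LinearEquiv.apply_symm_apply, Pi.single_apply]
        split_ifs
        · simp
          ring
        · simp
      rw [this, norm_smul, Real.norm_of_nonneg hs.le]
    have h := hg.real_ineq hdom hdom (hmem (2 * s) (by linarith) hsa)
      (hmem s hs (by linarith)) (t := 1 / 2) (c := 1 / 2 * μ * (s * D) ^ 2) (by norm_num)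
      (by positivity) (by rw [coe_nnnorm, hdist])
    simp only [sumPot, coord_comb, hcoord] at h
    -- The other coordinates equal `1` at both points, so only the `k`-th term of the gap survives.
    rw [Finset.mul_sum, Finset.mul_sum, ← Finset.sum_add_distrib, ← sub_nonneg, ← sub_sub,
      ← Finset.sum_sub_distrib, Finset.sum_eq_single k] at h
    · simp only [if_true] at h
      have h2 := pot_gap_le_of_two_lt hq2 hs
      have h3 : s ^ q = s ^ (q - 2) * s ^ 2 := by
        rw [← Real.rpow_natCast s 2, ← Real.rpow_add hs]
        congr 1
        push_cast
        ring
      rw [h3] at h2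
      refine le_of_mul_le_mul_right ?_ (pow_pos hs 2)
      linarith
    · intro j _ hj
      simp only [if_neg hj]
      have : (1 / 2 : ℝ) * 1 + (1 - 1 / 2) * 1 = 1 := by norm_num
      rw [this]
      ring
    · simp
  have hl : Tendsto (fun s : ℝ => coef q * 2 ^ q * s ^ (q - 2)) (𝓝[>] 0) (𝓝 0) := by
    have h1 := (Real.continuousAt_rpow_const 0 (q - 2) (Or.inr (by linarith))).tendsto
    rw [Real.zero_rpow (by linarith)] at h1
    simpa using (h1.mono_left nhdsWithin_le_nhds).const_mul (coef q * 2 ^ q)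
  have h3 := ge_of_tendsto hl (b := 1 / 8 * μ * D ^ 2) (by
    filter_upwards [Ioo_mem_nhdsGT (half_pos ha)] with s hs
    exact hkey s hs.1 (by linarith [hs.2]))
  have : 0 < 1 / 8 * μ * D ^ 2 := by positivity
  linarith

lemma IsStronglyConvexOn.mono {b : X → EReal} {S T : Set X} (h : IsStronglyConvexOn b T)
    (hST : S ⊆ T) : IsStronglyConvexOn b S := by
  obtain ⟨μ, hμ, hg⟩ := h
  exact ⟨μ, hμ, hg.1, fun x hx y hy => hg.2 x (hST hx) y (hST hy)⟩

lemma not_stronglyConvex_orthant (hn : 0 < n) (hq : 0 < q) (hq1 : q ≠ 1) (hq2 : q ≠ 2) :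
    ¬ IsStronglyConvexOn (tsallis e q) (orthant e) := by
  rcases hq2.lt_or_gt with h | h
  · rintro ⟨μ, -, hg⟩
    exact not_uniformlyConvex hn hq.ne' hq1 h ⟨_, hg⟩
  · intro hs
    refine not_stronglyConvex_interval h ⟨0, hn⟩ one_pos (hs.mono ?_)
    rintro _ ⟨⟨b, c, hb, hc, hbc, rfl⟩, hne⟩
    obtain rfl : c = 1 - b := by linarith
    rcases hb.eq_or_lt with h0 | h0
    · subst h0
      simp at hne
    · intro j
      rw [coord_comb, LinearEquiv.apply_symm_apply, LinearEquiv.apply_symm_apply,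
        Function.update_apply, Function.update_apply]
      split_ifs
      · linarith
      · simp

/-! ### Bregman properties for positive parameters -/

/-- For `q > 0` the real-valued sum is continuous on the whole space and the domain is closed, so
values only jump up to `⊤`. -/
lemma lowerSemicontinuous_tsallis (hq : 0 < q) : LowerSemicontinuous (tsallis e q) := by
  have hcoord : ∀ k, Continuous fun x => e x k := fun k => (coordFun e k).continuous
  have hcont : Continuous (sumPot e q) :=
    continuous_finsetSum _ fun k _ => (continuous_pot hq).comp (hcoord k)
  intro x a ha
  by_cases hx : x ∈ dom (tsallis e q)
  · rw [tsallis_of_mem_dom hx] at ha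
    have h1 : Continuous fun z => (sumPot e q z : EReal) := continuous_coe_real_ereal.comp hcont
    filter_upwards [(h1.tendsto x).eventually_const_lt ha] with z hz
    by_cases hzd : z ∈ dom (tsallis e q)
    · rwa [tsallis_of_mem_dom hzd]
    · rw [tsallis_of_notMem (mt mem_dom_iff.2 hzd)]
      exact hz.trans_le le_top
  · have hclosed : IsClosed (dom (tsallis e q)) := by
      have : dom (tsallis e q) = {x | ∀ k, 0 ≤ e x k} := by
        ext z
        simp [mem_dom_iff, potDom_of_pos hq]
      rw [this, ← closure_orthant]
      exact isClosed_closure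
    rw [tsallis_of_notMem (mt mem_dom_iff.2 hx)] at ha
    filter_upwards [hclosed.isOpen_compl.mem_nhds hx] with z hz
    rwa [tsallis_of_notMem (mt mem_dom_iff.2 hz)]

lemma bounded_levelSet₁_tsallis (hq : 0 < q) (hq1 : q ≠ 1) {x : X} (hx : x ∈ dom (tsallis e q))
    (γ : ℝ) : Bornology.IsBounded (levelSet₁ (tsallis e q) x γ) := by
  refine isBounded_of_coord e fun k => ?_
  obtain ⟨R, hR⟩ := le_of_potDiv_le hq hq1 (e x k) γ
  refine ⟨R, fun y hy => ?_⟩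
  obtain ⟨hy, hle⟩ := hy
  rw [interior_dom] at hy
  rw [divergence_tsallis hx hy, EReal.coe_le_coe_iff] at hle
  rw [abs_of_pos (hy k)]
  exact hR _ (hy k) ((potDiv_le_sumDiv hq.ne' hq1 hx hy k).trans hle)

lemma bounded_levelSet₂_tsallis (hq0 : q ≠ 0) (hq1 : q ≠ 1) {y : X} (hy : y ∈ orthant e)
    (γ : ℝ) : Bornology.IsBounded (levelSet₂ (tsallis e q) y γ) := by
  refine isBounded_of_coord e fun k => ?_
  obtain ⟨R, hR⟩ := le_of_potDiv_le' hq0 hq1 (hy k) γ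
  refine ⟨R, fun x hx => ?_⟩
  obtain ⟨hx, hle⟩ := hx
  rw [divergence_tsallis hx hy, EReal.coe_le_coe_iff] at hle
  rw [abs_of_nonneg (nonneg_of_mem_potDom (mem_dom_iff.1 hx k))]
  exact hR _ (mem_dom_iff.1 hx k) ((potDiv_le_sumDiv hq0 hq1 hx hy k).trans hle)

lemma tendsto_divergence_tsallis (hq : 0 < q) {x : X} (hx : x ∈ dom (tsallis e q)) {y : ℕ → X}
    (hy : ∀ i, y i ∈ orthant e) (h : Tendsto y atTop (𝓝 x)) :
    Tendsto (fun i => divergence (tsallis e q) x (y i)) atTop (𝓝 0) := by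
  simp_rw [divergence_tsallis hx (hy _)]
  refine EReal.tendsto_coe.2 ?_
  rw [show (0 : ℝ) = ∑ _k : Fin n, 0 by simp]
  exact tendsto_finsetSum _ fun k _ => tendsto_potDiv hq
    (nonneg_of_mem_potDom (mem_dom_iff.1 hx k)) (fun i => hy i k)
    (((coordFun e k).continuous.tendsto x).comp h)

/-- Bounded `y i` have coordinates at most some `R`. A coordinate gap of size `d` would then cost a
fixed amount of divergence. -/
lemma sequentiallyConsistent_tsallis (hq : 0 < q) (hq1 : q ≠ 1) :
    SequentiallyConsistent (tsallis e q) := by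
  intro x y hx hy hb h
  rw [interior_dom] at hy
  simp_rw [divergence_tsallis (hx _) (hy _)] at h
  have h : Tendsto (fun i => sumDiv e q (x i) (y i)) atTop (𝓝 0) := EReal.tendsto_coe.1 h
  obtain ⟨C, hC⟩ := isBounded_iff_forall_norm_le.1 hb
  set R := max 1 (‖(coordCLE e : X →L[ℝ] (Fin n → ℝ))‖ * C) with hR
  have hyR : ∀ i k, e (y i) k ≤ R := fun i k =>
    ((le_abs_self _).trans ((abs_coord_le e (y i) k).trans
      (mul_le_mul_of_nonneg_left (hC _ ⟨i, rfl⟩) (norm_nonneg _)))).trans (le_max_right _ _)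
  have hlim : Tendsto (fun i => x i - y i) atTop (𝓝 0) := by
    refine tendsto_of_coord e fun k => ?_
    rw [Metric.tendsto_atTop]
    intro d hd
    obtain ⟨ε, hε, hge⟩ := exists_potDiv_ge hq hq1 (R := R) (lt_max_of_lt_left one_pos) hd
    obtain ⟨N, hN⟩ := eventually_atTop.1 (h.eventually_lt_const hε)
    refine ⟨N, fun i hi => ?_⟩
    by_contra hlt
    rw [not_lt, Real.dist_eq, map_sub, map_zero, Pi.sub_apply, Pi.zero_apply, sub_zero] at hlt
    have h1 := hge _ _ (nonneg_of_mem_potDom (mem_dom_iff.1 (hx i) k)) (hy i k) (hyR i k) hlt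
    have h2 := potDiv_le_sumDiv hq.ne' hq1 (hx i) (hy i) k
    linarith [hN i hi]
  simpa using hlim.norm

/-- The terms `b (y i)` cancel in the difference, leaving the gradient at `y i` applied to `x - z`;
it converges because weak convergence gives coordinatewise convergence and `dpot q` is continuous at
positive points. -/
lemma limitingDifference_tsallis : LimitingDifference (tsallis e q) := by
  intro x hx y hy z hz h
  rw [interior_dom] at hy hz
  have hzd : z ∈ dom (tsallis e q) := orthant_subset_dom hz
  simp_rw [divergence_tsallis hx (hy _), divergence_tsallis hzd (hy _)]
  rw [divergence_tsallis hx hz]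
  have h1 : ∀ i, ((sumDiv e q x (y i) : EReal) - (sumDiv e q z (y i) : EReal))
      = ((sumPot e q x - sumPot e q z - gradPot e q (y i) (x - z) : ℝ) : EReal) := fun i => by
    rw [← EReal.coe_sub, sumDiv_eq, sumDiv_eq]
    congr 1
    simp only [map_sub]
    ring
  simp_rw [h1]
  rw [sumDiv_eq]
  refine EReal.tendsto_coe.2 (tendsto_const_nhds.sub ?_)
  simp_rw [gradPot_apply]
  exact tendsto_finsetSum _ fun k _ =>
    ((continuousAt_dpot (hz k)).tendsto.comp (h (coordFun e k))).mul_const _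

lemma isBregman_tsallis (hq : 0 < q) (hq1 : q ≠ 1) : IsBregman (tsallis e q) (orthant e) where
  ne_bot := tsallis_ne_bot
  zone_nonempty := ⟨_, one_mem_orthant⟩
  zone_eq := interior_dom.symm
  differentiable _ hy := ⟨_, hasGateauxDerivAt_tsallis hy⟩
  convex := isConvex_tsallis hq.ne' hq1
  lsc := lowerSemicontinuous_tsallis hq
  strictlyConvex := isStrictlyConvexOn_tsallis hq.ne' hq1
  bounded_levelSet γ _ hx := bounded_levelSet₁_tsallis hq hq1 hx γ
  tendsto_divergence _ hx _ hy h := tendsto_divergence_tsallis hq hx hy h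
  -- A convergent sequence `y` is bounded, so sequential consistency applies.
  tendsto_of_divergence x y hx hy _ h z _ hyz := by
    have h1 := sequentiallyConsistent_tsallis hq hq1 x y hx (by rwa [interior_dom])
      (Metric.isBounded_range_of_tendsto y hyz) h
    simpa using (tendsto_zero_iff_norm_tendsto_zero.2 h1).add hyz

/-! ### Unbounded level sets for negative parameters -/

lemma unbounded_levelSet₁_tsallis (hn : 0 < n) (hq : q < 0) {x : X} (hx : x ∈ orthant e) {γ : ℝ}
    (hγ : ∀ k, (n : ℝ) * (e x k) ^ q / (1 - q) < γ) :
    ¬ Bornology.IsBounded (levelSet₁ (tsallis e q) x γ) := by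
  intro hb
  have hl : Tendsto (fun t : ℝ => sumDiv e q x (e.symm fun _ => t)) atTop
      (𝓝 (∑ k, (e x k) ^ q / (1 - q))) := by
    simp only [sumDiv, LinearEquiv.apply_symm_apply]
    exact tendsto_finsetSum _ fun k _ => tendsto_potDiv_atTop hq
  have hlt : ∑ k, (e x k) ^ q / (1 - q) < γ := by
    have hn' : (0 : ℝ) < n := by exact_mod_cast hn
    have : Nonempty (Fin n) := ⟨⟨0, hn⟩⟩
    -- Each of the `n` limits is below `γ / n`, so the limit along the diagonal is strictly below
    -- `γ`.
    have h1 : ∑ k, (e x k) ^ q / (1 - q) < ∑ _k : Fin n, γ / n :=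
      Finset.sum_lt_sum_of_nonempty Finset.univ_nonempty fun k _ => by
        rw [lt_div_iff₀ hn']
        refine lt_of_eq_of_lt ?_ (hγ k)
        ring
    refine h1.trans_eq ?_
    rw [Finset.sum_const, Finset.card_univ, Fintype.card_fin, nsmul_eq_mul]
    field_simp
  obtain ⟨C, hC⟩ := isBounded_iff_forall_norm_le.1 hb
  obtain ⟨t, ht1, ht2, ht3⟩ := ((hl.eventually_lt_const hlt).and ((eventually_gt_atTop 0).and
    (eventually_gt_atTop (‖(coordCLE e : X →L[ℝ] (Fin n → ℝ))‖ * C)))).exists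
  have hy : e.symm (fun _ => t) ∈ orthant e := fun k => by simpa using ht2
  have h1 := hC (e.symm fun _ => t) ⟨by rwa [interior_dom], by
    rw [divergence_tsallis (orthant_subset_dom hx) hy]
    exact_mod_cast ht1.le⟩
  have h2 := abs_coord_le e (e.symm fun _ => t) ⟨0, hn⟩
  rw [LinearEquiv.apply_symm_apply] at h2
  have h3 := h2.trans (mul_le_mul_of_nonneg_left h1 (norm_nonneg _))
  linarith [le_abs_self t]

lemma not_isBregman_tsallis (hn : 0 < n) (hq : q < 0) (U : Set X) :
    ¬ IsBregman (tsallis e q) U := by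
  intro h
  -- At the all-ones point the threshold is `n / (1 - q)`; adding `1` makes the inequality strict.
  refine unbounded_levelSet₁_tsallis (e := e) hn hq one_mem_orthant (γ := n / (1 - q) + 1)
    (fun k => ?_) (h.bounded_levelSet _ _ (orthant_subset_dom one_mem_orthant))
  simp

end Vector

end BregmanTsallis

end

/-! ### The main theorem -/

open BregmanTsallis in
theorem mainTheorem6 {X : Type*} [NormedAddCommGroup X] [NormedSpace ℝ X] {n : ℕ} (hn : 0 < n)
    (e : X ≃ₗ[ℝ] (Fin n → ℝ)) (q : ℝ) (hq0 : q ≠ 0) (hq1 : q ≠ 1) :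
    -- the setting is meaningful: `b` is a convex pre-Bregman function with zone `U`,
    -- and constants comparing the norms exist
    (IsConvex (tsallis e q) ∧ IsPreBregman (tsallis e q) ∧
      interior (dom (tsallis e q)) = orthant e ∧
      ∃ c₂ cinf : ℝ, AreNormConstants e c₂ cinf) ∧
    -- `q < 2`: strong convexity on bounded convex subsets of the effective domain
    (q < 2 → ∀ c₂ cinf : ℝ, AreNormConstants e c₂ cinf →
      ∀ S : Set X, S.Nonempty → Convex ℝ S → S ⊆ dom (tsallis e q) →
        ∀ M : ℝ, 0 < M → (∀ s ∈ S, ‖s‖ ≤ M) →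
          IsStrongConvexityParameter (tsallis e q) S
            (|q| * c₂ ^ 2 / (cinf * M) ^ (2 - q))) ∧
    -- `q < 2`: relative uniform convexity with a gauge proportional to `t ^ q`
    (q < 2 → ∀ c₂ cinf : ℝ, AreNormConstants e c₂ cinf →
      ∀ x ∈ dom (tsallis e q),
        IsRelativeGauge (tsallis e q) {x} (orthant e ∩ {w | 2 * ‖x‖ < ‖w‖})
          (tsallisGauge q c₂ cinf)) ∧
    -- `q = 2`: strong convexity on the whole effective domain
    (q = 2 → ∀ c₂ cinf : ℝ, AreNormConstants e c₂ cinf →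
      IsStrongConvexityParameter (tsallis e q) (dom (tsallis e q)) (2 * c₂ ^ 2)) ∧
    -- `q > 2`: strong convexity away from the boundary of `U`
    (2 < q → ∀ c₂ cinf : ℝ, AreNormConstants e c₂ cinf → ∀ ε : ℝ, 0 < ε →
      ∀ V : Set X, V.Nonempty → (∀ z ∈ V, ∀ k, ε ≤ e z k) →
        IsStrongConvexityParameter (tsallis e q) V (q * c₂ ^ 2 * ε ^ (q - 2))) ∧
    (2 < q → ∀ V : Set X, V.Nonempty → V ⊆ orthant e →
      (∃ δ : ℝ, 0 < δ ∧ ∀ z ∈ V, ∀ w ∈ frontier (orthant e), δ ≤ ‖z - w‖) →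
        IsStronglyConvexOn (tsallis e q) V) ∧
    -- no strong convexity on `U`; for `q > 2` not even on some bounded half-open intervals
    (0 < q → q ≠ 2 → ¬ IsStronglyConvexOn (tsallis e q) (orthant e)) ∧
    (2 < q → ∀ k : Fin n, ∀ a : ℝ, 0 < a →
      ¬ IsStronglyConvexOn (tsallis e q)
        (segment ℝ (e.symm (Function.update 1 k a)) (e.symm (Function.update 1 k 0)) \
          {e.symm (Function.update 1 k 0)})) ∧
    -- no uniform convexity on `U` for `q = 1 / 2`
    (q = 1 / 2 → ¬ IsUniformlyConvexOn (tsallis e q) (orthant e)) ∧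
    -- `q > 0`: a sequentially consistent Bregman function with the limiting difference property
    (0 < q → IsBregman (tsallis e q) (orthant e) ∧ SequentiallyConsistent (tsallis e q) ∧
      LimitingDifference (tsallis e q) ∧
      ∀ γ : ℝ, ∀ y ∈ orthant e, Bornology.IsBounded (levelSet₂ (tsallis e q) y γ)) ∧
    -- `q < 0`: not a Bregman function, because of unbounded level-sets
    (q < 0 → (∀ U : Set X, ¬ IsBregman (tsallis e q) U) ∧
      ∀ x : X, (∀ k, 1 ≤ e x k) →
        ∀ γ : ℝ, (∀ k, (n : ℝ) * (e x k) ^ q / (1 - q) < γ) →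
          ¬ Bornology.IsBounded (levelSet₁ (tsallis e q) x γ)) := by
  refine ⟨⟨isConvex_tsallis hq0 hq1, isPreBregman_tsallis, interior_dom,
    exists_areNormConstants e⟩, ?_, ?_, ?_, ?_, ?_, ?_, ?_, ?_, ?_, ?_⟩
  · intro h2 c₂ cinf hc S _ _ hS M hM hSM
    exact strongConvexity_of_bounded hq0 hq1 h2 hc hS hM hSM
  · intro h2 c₂ cinf hc x hx
    exact relativeGauge_tsallis hq0 hq1 h2 hc hx
  · rintro rfl c₂ cinf hc
    exact strongConvexity_two hc
  · intro h2 c₂ cinf hc ε hε V _ hV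
    exact strongConvexity_of_ge h2 hc hε hV
  · rintro h2 V _ hV ⟨δ, hδ, h⟩
    exact stronglyConvex_of_dist h2 hV hδ h
  · intro h0 h2
    exact not_stronglyConvex_orthant hn h0 hq1 h2
  · intro h2 k a ha
    exact not_stronglyConvex_interval h2 k ha
  · intro h
    exact not_uniformlyConvex hn hq0 hq1 (by rw [h]; norm_num)
  · intro h0
    exact ⟨isBregman_tsallis h0 hq1, sequentiallyConsistent_tsallis h0 hq1,
      limitingDifference_tsallis, fun γ y hy => bounded_levelSet₂_tsallis hq0 hq1 hy γ⟩
  · intro h0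
    exact ⟨not_isBregman_tsallis hn h0, fun x hx γ hγ =>
      unbounded_levelSet₁_tsallis hn h0 (fun k => one_pos.trans_le (hx k)) hγ⟩
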